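/- Let $\Bbbk$ be a subfield of $\mathbb{C}$. For $n\ge 0$ let $$\mathcal A^*_n=\frac{\bigwedge^*_{\Bbbk}\big[\,a_{i,j}\;:\;i,j\in\{1,\dots,n\},\ i\neq j,\ a_{i,j}=a_{j,i}\,\big]}{\big(a_{i,j}a_{j,k}+a_{j,k}a_{k,i}+a_{k,i}a_{i,j}\;:\;i,j,k\text{ pairwise distinct}\big)}$$ be the Arnold algebra, graded with each $a_{i,j}$ in degree $1$, and let $\mathcal A^d_n$ be its $d$-th graded piece, on which the symmetric group $S_n$ acts by $\sigma\cdot a_{i,j}=a_{\sigma(i),\sigma(j)}$. For $r\ge 1$ and $\sigma\in S_n$ let $X_r(\sigma)$ be the number of $r$-cycles of $\sigma$ (with fixed points counted as $1$-cycles); a character polynomial $P\in\Bbbk[X_1,X_2,\dots]$ defines a class function $P_n$ on $S_n$ for every $n$. Write $\langle f,g\rangle_{S_n}=\frac1{n!}\sum_{\sigma\in S_n}f(\sigma)\overline{g(\sigma)}$, where a representation stands for its character. Then for every character polynomial $P$ the limit $\lim_{n\to\infty}\langle P_n,\mathcal A^d_n\rangle_{S_n}$ exists for each $d\ge 0$,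 and for every real number $q\ge 3$ the series $$\sum_{d=0}^{\infty}\frac{\lim_{n\to\infty}\langle P_n,\mathcal A^d_n\rangle_{S_n}}{q^d}$$ converges absolutely. -/

import Mathlib

open Filter Topology

/-- The index set of the generators: unordered pairs of distinct elements of `V`. -/
abbrev ArnoldPair (V : Type*) : Type _ := {e : Sym2 V // ¬ e.IsDiag}

/-- The action of a permutation of `V` on unordered pairs of distinct elements. -/
def ArnoldPair.perm {V : Type*} (σ : Equiv.Perm V) (e : ArnoldPair V) : ArnoldPair V :=
  ⟨Sym2.map σ e.1, fun h => e.2 ((Sym2.isDiag_map σ.injective).1 h)⟩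

noncomputable section

/-- The exterior algebra on the free module with basis the symbols `a_{i,j} = a_{j,i}`, `i ≠ j`. -/
abbrev ArnoldExterior (K V : Type*) [CommRing K] : Type _ :=
  ExteriorAlgebra K (ArnoldPair V →₀ K)

/-- The generator `a_{i,j}` of the exterior algebra. -/
def ArnoldExterior.gen (K : Type*) {V : Type*} [CommRing K] (i j : V) (h : i ≠ j) :
    ArnoldExterior K V :=
  ExteriorAlgebra.ι K (Finsupp.single (⟨s(i, j), fun hd => h (Sym2.mk_isDiag_iff.1 hd)⟩) 1)

/-- The Arnold relations `a_{i,j} a_{j,k} + a_{j,k} a_{k,i} + a_{k,i} a_{i,j} = 0`,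
for pairwise distinct `i, j, k`. -/
inductive ArnoldRel (K V : Type*) [CommRing K] : ArnoldExterior K V → ArnoldExterior K V → Prop
  | arnold (i j k : V) (hij : i ≠ j) (hjk : j ≠ k) (hki : k ≠ i) :
      ArnoldRel K V
        (ArnoldExterior.gen K i j hij * ArnoldExterior.gen K j k hjk
          + ArnoldExterior.gen K j k hjk * ArnoldExterior.gen K k i hki
          + ArnoldExterior.gen K k i hki * ArnoldExterior.gen K i j hij)
        0

/-- The Arnold algebra over `K` on the vertex set `V`: the quotient of the exterior algebra by the
two-sided ideal generated by the Arnold relations. -/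
abbrev ArnoldAlgebra (K V : Type*) [CommRing K] : Type _ := RingQuot (ArnoldRel K V)

namespace ArnoldAlgebra

variable (K : Type*) {V : Type*} [CommRing K]

/-- The quotient map from the exterior algebra. -/
def mk : ArnoldExterior K V →ₐ[K] ArnoldAlgebra K V :=
  RingQuot.mkAlgHom K (ArnoldRel K V)

/-- The algebra endomorphism of the exterior algebra with `a_{i,j} ↦ a_{σ i, σ j}`. -/
def permExterior (σ : Equiv.Perm V) : ArnoldExterior K V →ₐ[K] ArnoldExterior K V :=
  ExteriorAlgebra.map (Finsupp.lmapDomain K K (ArnoldPair.perm σ))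

theorem permExterior_gen (σ : Equiv.Perm V) (i j : V) (h : i ≠ j) :
    permExterior K σ (ArnoldExterior.gen K i j h)
      = ArnoldExterior.gen K (σ i) (σ j) (σ.injective.ne h) := by
  simp [permExterior, ArnoldExterior.gen, ArnoldPair.perm, Finsupp.mapDomain_single]

/-- The algebra endomorphism of the Arnold algebra with `a_{i,j} ↦ a_{σ i, σ j}`. -/
def permHom (σ : Equiv.Perm V) : ArnoldAlgebra K V →ₐ[K] ArnoldAlgebra K V :=
  RingQuot.liftAlgHom K ⟨(mk K).comp (permExterior K σ), by
    rintro _ _ ⟨i, j, k, hij, hjk, hki⟩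
    simp only [AlgHom.comp_apply, map_add, map_mul, permExterior_gen, map_zero]
    have h := RingQuot.mkAlgHom_rel K (ArnoldRel.arnold (K := K) (σ i) (σ j) (σ k)
      (σ.injective.ne hij) (σ.injective.ne hjk) (σ.injective.ne hki))
    simp only [map_add, map_mul, map_zero] at h
    exact h⟩

theorem permHom_mk (σ : Equiv.Perm V) (x : ArnoldExterior K V) :
    permHom K σ (mk K x) = mk K (permExterior K σ x) :=
  RingQuot.liftAlgHom_mkAlgHom_apply K _ _ x

theorem mk_surjective : Function.Surjective (mk K : ArnoldExterior K V → ArnoldAlgebra K V) :=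
  RingQuot.mkAlgHom_surjective K _

/-- The action of the permutations of `V` on the Arnold algebra. -/
def rep (V : Type*) : Representation K (Equiv.Perm V) (ArnoldAlgebra K V) where
  toFun σ := (permHom K σ).toLinearMap
  map_one' := by
    ext x
    obtain ⟨y, rfl⟩ := mk_surjective K x
    have h : (Finsupp.lmapDomain K K (ArnoldPair.perm (1 : Equiv.Perm V))) = LinearMap.id := by
      have : ArnoldPair.perm (1 : Equiv.Perm V) = id := by
        funext e
        simp [ArnoldPair.perm, Equiv.Perm.coe_one]
      rw [this, Finsupp.lmapDomain_id]
    simp [permHom_mk, permExterior, h]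
  map_mul' σ τ := by
    ext x
    obtain ⟨y, rfl⟩ := mk_surjective K x
    have h : (Finsupp.lmapDomain K K (ArnoldPair.perm (σ * τ)))
        = (Finsupp.lmapDomain K K (ArnoldPair.perm σ)).comp
          (Finsupp.lmapDomain K K (ArnoldPair.perm τ)) := by
      have : ArnoldPair.perm (σ * τ) = ArnoldPair.perm σ ∘ ArnoldPair.perm τ := by
        funext e
        simp [ArnoldPair.perm, Equiv.Perm.coe_mul, Sym2.map_map]
      rw [this, Finsupp.lmapDomain_comp]
    simp [permHom_mk, permExterior, h, ← ExteriorAlgebra.map_comp_map]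

/-- The `d`-th graded piece of the Arnold algebra: the image of the `d`-th exterior power. -/
def piece (V : Type*) (d : ℕ) : Submodule K (ArnoldAlgebra K V) :=
  (⋀[K]^d (ArnoldPair V →₀ K)).map (mk K).toLinearMap

theorem piece_le_comap (d : ℕ) (σ : Equiv.Perm V) :
    piece K V d ≤ (piece K V d).comap (rep K V σ) := by
  rintro _ ⟨x, hx, rfl⟩
  refine ⟨permExterior K σ x, ?_, (permHom_mk K σ x).symm⟩
  have h : ((⋀[K]^d (ArnoldPair V →₀ K)).map (permExterior K σ).toLinearMap)
      ≤ ⋀[K]^d (ArnoldPair V →₀ K) := by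
    rw [Submodule.map_pow]
    refine pow_le_pow_left' ?_ d
    rintro _ ⟨_, ⟨m, rfl⟩, rfl⟩
    exact ⟨_, (ExteriorAlgebra.map_apply_ι _ m).symm⟩
  exact h ⟨x, hx, rfl⟩

/-- The `d`-th graded piece of the Arnold algebra as a representation of the permutations of `V`. -/
def pieceRep (V : Type*) (d : ℕ) : Representation K (Equiv.Perm V) (piece K V d) :=
  (rep K V).subrepresentation (piece K V d) (piece_le_comap K d)

end ArnoldAlgebra

/-- `X_r(σ)`: the number of `r`-cycles of `σ`, where the fixed points are the `1`-cycles. -/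
def cycleCount {n : ℕ} (r : ℕ+) (σ : Equiv.Perm (Fin n)) : ℕ :=
  σ.partition.parts.count (r : ℕ)

/-- The class function `P_n` on `S_n` defined by a character polynomial `P ∈ K[X_1, X_2, …]`. -/
def charPolyFun {K : Type*} [CommRing K] (P : MvPolynomial ℕ+ K) (n : ℕ)
    (σ : Equiv.Perm (Fin n)) : K :=
  MvPolynomial.eval (fun r => (cycleCount r σ : K)) P

/-- The standard inner product of complex-valued class functions on a finite group. -/
def classInner {G : Type*} [Group G] [Fintype G] (f g : G → ℂ) : ℂ :=
  (Fintype.card G : ℂ)⁻¹ * ∑ x : G, f x * starRingEnd ℂ (g x)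

/-- `⟨P_n, A^d_n⟩_{S_n}`: the inner product of `P_n` with the character of the `d`-th graded
piece of the Arnold algebra on `{1, …, n}` over `K ⊆ ℂ`. -/
def arnoldInner (K : Subfield ℂ) (P : MvPolynomial ℕ+ K) (d n : ℕ) : ℂ :=
  classInner (fun σ : Equiv.Perm (Fin n) => ((charPolyFun P n σ : K) : ℂ))
    (fun σ => (((ArnoldAlgebra.pieceRep K (Fin n) d).character σ : K) : ℂ))

end

/-! For a finite set `Y` with a permutation `c`, let `labelFix c σ` be the number of `f : Y → V`
with `σ ∘ f ∘ c = f`. If `c` is an `r`-cycle this is the number of fixed points of `σ ^ r`, that is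
`∑ s * X_s` over the divisors `s` of `r`, and disjoint unions of `Y` give products. Hence every
character polynomial is a linear combination of functions `labelFix c`
(`charPolyFun_mem_labelSpan`), and it is enough to treat one of them.

The average of `labelFix c` against the character of the degree `d` piece is the trace of the
relabelling by `c` on the `S_n`-coinvariants of the elements of that piece labelled by functions `Y
→ Fin n` (`trace_relabelCoinv`). A product of `d` edges and its labels occupy at most `2 * d + |Y|`
vertices, so beyond this bound the coinvariants for `n` surject onto those for `n + 1`. Their
dimensions decrease and become constant, the surjections become isomorphisms commuting with `c`, and
the trace becomes constant.

For absolute convergence, `c` has finite order, so its trace is bounded in norm by the dimension,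
hence by the dimension at `n = 2 * d + |Y|`. The Arnold relation rewrites any monomial into products
of disjoint paths. Up to a permutation of the vertices such a product depends only on the lengths of
its nontrivial paths, a composition of `d`; so the dimension is at most `2 ^ d * n ^ |Y|`
(`finrank_arnoldCoinv_le`). The limits grow at most like `2 ^ d` times a polynomial in `d`, which is
summable against `q ^ d` for every `q > 2`. -/

noncomputable section

/-! ### Rewriting monomials of the Arnold algebra into disjoint paths -/

namespace ArnoldAlgebra

variable (K : Type*) {V : Type*} [CommRing K]

open Classical in
/-- The class of `a_{i,j}` in the Arnold algebra, with the convention `a_{i,i} = 0`. -/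
def edge (i j : V) : ArnoldAlgebra K V :=
  if h : i ≠ j then mk K (ArnoldExterior.gen K i j h) else 0

theorem edge_of_ne {i j : V} (h : i ≠ j) : edge K i j = mk K (ArnoldExterior.gen K i j h) := by
  simp [edge, h]

@[simp] theorem edge_self (i : V) : edge K i i = 0 := by simp [edge]

theorem edge_symm (i j : V) : edge K i j = edge K j i := by
  by_cases h : i = j
  · rw [h]
  · rw [edge_of_ne K h, edge_of_ne K (Ne.symm h)]
    simp only [ArnoldExterior.gen, Sym2.eq_swap]

theorem edge_anticomm (i j k l : V) : edge K i j * edge K k l = -(edge K k l * edge K i j) := by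
  by_cases h : i = j
  · simp [h]
  by_cases h' : k = l
  · simp [h']
  rw [edge_of_ne K h, edge_of_ne K h', ← map_mul, ← map_mul, ← map_neg]
  exact congrArg (mk K) (eq_neg_of_add_eq_zero_left (ExteriorAlgebra.ι_add_mul_swap _ _))

theorem edge_mul_self (i j : V) : edge K i j * edge K i j = 0 := by
  by_cases h : i = j
  · simp [h]
  rw [edge_of_ne K h, ← map_mul, ArnoldExterior.gen, ExteriorAlgebra.ι_sq_zero, map_zero]

theorem edge_arnold (i j k : V) :
    edge K i j * edge K j k + edge K j k * edge K k i + edge K k i * edge K i j = 0 := by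
  by_cases hij : i = j
  · subst hij
    simp [edge_symm K k i, edge_mul_self]
  by_cases hjk : j = k
  · subst hjk
    simp [edge_symm K j i, edge_mul_self]
  by_cases hki : k = i
  · subst hki
    simp [edge_symm K j k, edge_mul_self]
  rw [edge_of_ne K hij, edge_of_ne K hjk, edge_of_ne K hki]
  have h := RingQuot.mkAlgHom_rel K (ArnoldRel.arnold (K := K) i j k hij hjk hki)
  simp only [map_add, map_mul, map_zero] at h
  exact h

/-- The Arnold relation as a rule for rewriting two edges at `i`. -/
theorem edge_mul_edge_same (i x y : V) :
    edge K i x * edge K i y = edge K i x * edge K x y - edge K i y * edge K x y := by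
  have h := edge_arnold K i x y
  rw [edge_symm K y i, edge_anticomm K i y i x, edge_anticomm K x y i y] at h
  rw [← sub_eq_zero, ← neg_eq_zero, ← h]
  abel

/-- The product of the edges of a path. -/
def path : List V → ArnoldAlgebra K V
  | [] => 1
  | [_] => 1
  | x :: y :: l => edge K x y * path (y :: l)

/-- If `x` is attached at the start `i`, the Arnold relation either inserts `x` right after `i` or
moves the attachment to the next vertex; otherwise the first edge is passed over. Keeping the start
`i` fixed is what lets the induction put the first edge back in front. -/
theorem edge_mul_path_mem_span (x y : V) : ∀ (l : List V) (i : V), y ∈ i :: l →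
    edge K x y * path K (i :: l)
      ∈ Submodule.span K {z | ∃ l', l'.Perm (x :: l) ∧ z = path K (i :: l')}
  | [], i, h => by
    obtain rfl : y = i := by simpa using h
    refine Submodule.subset_span ⟨[x], List.Perm.refl _, ?_⟩
    simp [path, edge_symm K x y]
  | z :: l, i, h => by
    have step : ∀ y', y' ∈ z :: l → edge K i z * (edge K x y' * path K (z :: l)) ∈
        Submodule.span K {w | ∃ l', l'.Perm (x :: z :: l) ∧ w = path K (i :: l')} := by
      intro y' h'
      have ih := Submodule.mem_map_of_mem (f := LinearMap.mulLeft K (edge K i z))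
        (edge_mul_path_mem_span x y' l z h')
      rw [Submodule.map_span] at ih
      refine Submodule.span_mono ?_ ih
      rintro _ ⟨_, ⟨l', hl', rfl⟩, rfl⟩
      exact ⟨z :: l', (hl'.cons z).trans (List.Perm.swap x z l), rfl⟩
    by_cases hy : y = i
    · subst hy
      have : edge K x y * path K (y :: z :: l)
          = path K (y :: x :: z :: l) - edge K y z * (edge K x z * path K (z :: l)) := by
        simp only [path]
        rw [edge_symm K x y, ← mul_assoc, edge_mul_edge_same, sub_mul, mul_assoc, mul_assoc]
      rw [this]
      exact Submodule.sub_mem _ (Submodule.subset_span ⟨_, List.Perm.refl _, rfl⟩)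
        (step z (by simp))
    · have h' : y ∈ z :: l := (List.mem_cons.1 h).resolve_left hy
      have : edge K x y * path K (i :: z :: l)
          = -(edge K i z * (edge K x y * path K (z :: l))) := by
        simp only [path]
        rw [← mul_assoc, edge_anticomm, neg_mul, mul_assoc]
      rw [this]
      exact Submodule.neg_mem _ (step y h')

/-- The sign is the parity of the length of the path; it is left undetermined because only
membership in spans matters. -/
theorem edge_mul_path_comm (x y : V) : ∀ l : List V,
    edge K x y * path K l = path K l * edge K x y ∨
      edge K x y * path K l = -(path K l * edge K x y)
  | [] => by simp [path]
  | [_] => by simp [path]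
  | u :: v :: l => by
    simp only [path]
    rw [← mul_assoc, edge_anticomm, neg_mul, mul_assoc]
    rcases edge_mul_path_comm x y (v :: l) with h | h <;> rw [h]
    · right; rw [mul_assoc]
    · left; rw [mul_assoc]; simp

/-- The product of the edges of a disjoint union of paths. -/
def forest (L : List (List V)) : ArnoldAlgebra K V := (L.map (path K)).prod

theorem forest_cons (l : List V) (L : List (List V)) :
    forest K (l :: L) = path K l * forest K L := by simp [forest]

/-- Up to sign the edge moves past the earlier paths to one that contains `y`, and that path absorbs
`x`. The number of paths does not change. -/
theorem edge_mul_forest_mem_span (x y : V) : ∀ L : List (List V), y ∈ L.flatten →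
    (∀ l ∈ L, l ≠ []) → edge K x y * forest K L ∈
      Submodule.span K {z | ∃ L' : List (List V), L'.flatten.Perm (x :: L.flatten) ∧
        (∀ l ∈ L', l ≠ []) ∧ L'.length = L.length ∧ z = forest K L'}
  | [], h, _ => by simp at h
  | l :: L, h, hL => by
    by_cases hy : y ∈ l
    · obtain ⟨i, l, rfl⟩ := List.exists_cons_of_ne_nil (hL l (by simp))
      have ih := Submodule.mem_map_of_mem (f := LinearMap.mulRight K (forest K L))
        (edge_mul_path_mem_span K x y l i hy)
      rw [Submodule.map_span, LinearMap.mulRight_apply, mul_assoc, ← forest_cons] at ih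
      refine Submodule.span_mono ?_ ih
      rintro _ ⟨_, ⟨l', hl', rfl⟩, rfl⟩
      refine ⟨(i :: l') :: L, ?_, ?_, rfl, ?_⟩
      · simp only [List.flatten_cons, List.cons_append]
        exact ((hl'.append_right _).cons i).trans (List.Perm.swap x i _)
      · simpa using fun l hl => hL l (by simp [hl])
      · simp [forest_cons]
    · have hy' : y ∈ L.flatten := by
        rw [List.flatten_cons, List.mem_append] at h
        exact h.resolve_left hy
      have ih := Submodule.mem_map_of_mem (f := LinearMap.mulLeft K (path K l))
        (edge_mul_forest_mem_span x y L hy' fun l hl => hL l (by simp [hl]))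
      rw [Submodule.map_span, LinearMap.mulLeft_apply] at ih
      have key : path K l * (edge K x y * forest K L) ∈
          Submodule.span K {z | ∃ L' : List (List V),
            L'.flatten.Perm (x :: (l :: L).flatten) ∧
            (∀ l ∈ L', l ≠ []) ∧ L'.length = (l :: L).length ∧ z = forest K L'} := by
        refine Submodule.span_mono ?_ ih
        rintro _ ⟨_, ⟨L', h1, h2, h3, rfl⟩, rfl⟩
        refine ⟨l :: L', ?_, ?_, by simp [h3], by simp [forest_cons]⟩
        · simp only [List.flatten_cons]
          exact (h1.append_left l).trans List.perm_middle
        · intro l' hl'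
          rcases List.mem_cons.1 hl' with rfl | hl'
          · exact hL _ (by simp)
          · exact h2 _ hl'
      rw [forest_cons, ← mul_assoc]
      rcases edge_mul_path_comm K x y l with h | h <;> rw [h]
      · rwa [mul_assoc]
      · rw [neg_mul, mul_assoc]
        exact Submodule.neg_mem _ key

/-- Monomials of degree `d` on the vertices `T`, built by adding the vertices one at a time, each
joined to at most one earlier vertex. -/
inductive IncMonomial : List V → ℕ → ArnoldAlgebra K V → Prop
  | nil : IncMonomial [] 0 1
  | skip {T d x} (v : V) : IncMonomial T d x → IncMonomial (v :: T) d x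
  | attach {T d x} (v i : V) : i ∈ T → IncMonomial T d x →
      IncMonomial (v :: T) (d + 1) (edge K v i * x)

variable {K}

/-- Two edges at the newest vertex `v` are traded, by the Arnold relation, for one edge at `v` and
one edge between earlier vertices, which the induction hypothesis absorbs. -/
theorem IncMonomial.edge_mul_mem_span {T : List V} {d : ℕ} {x : ArnoldAlgebra K V}
    (hx : IncMonomial K T d x) : ∀ {i j : V}, i ∈ T → j ∈ T →
      edge K i j * x ∈ Submodule.span K {z | IncMonomial K T (d + 1) z} := by
  induction hx with
  | nil => intro i j hi; simp at hi
  | @skip T d x v hx ih =>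
    intro i j hi hj
    rcases List.mem_cons.1 hi with rfl | hi' <;> rcases List.mem_cons.1 hj with rfl | hj'
    · simp
    · exact Submodule.subset_span (.attach _ _ hj' hx)
    · rw [edge_symm]
      exact Submodule.subset_span (.attach _ _ hi' hx)
    · exact Submodule.span_mono (fun z hz => .skip v hz) (ih hi' hj')
  | @attach T d x v k hk hx ih =>
    intro i j hi hj
    have step : ∀ {u i j : V}, u ∈ T → i ∈ T → j ∈ T → edge K v u * (edge K i j * x) ∈
        Submodule.span K {z | IncMonomial K (v :: T) (d + 1 + 1) z} := by
      intro u i j hu hi hj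
      have h := Submodule.mem_map_of_mem (f := LinearMap.mulLeft K (edge K v u)) (ih hi hj)
      rw [Submodule.map_span] at h
      refine Submodule.span_mono ?_ h
      rintro _ ⟨z, hz, rfl⟩
      exact .attach _ _ hu hz
    have two : ∀ {j : V}, j ∈ T → edge K v j * (edge K v k * x) ∈
        Submodule.span K {z | IncMonomial K (v :: T) (d + 1 + 1) z} := by
      intro j hj
      rw [← mul_assoc, edge_mul_edge_same, sub_mul, mul_assoc, mul_assoc]
      exact Submodule.sub_mem _ (step hj hj hk) (step hk hj hk)
    rcases List.mem_cons.1 hi with rfl | hi' <;> rcases List.mem_cons.1 hj with rfl | hj'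
    · simp
    · exact two hj'
    · rw [edge_symm K i]
      exact two hi'
    · rw [← mul_assoc, edge_anticomm, neg_mul, mul_assoc]
      exact Submodule.neg_mem _ (step hk hi' hj')

/-- A skipped vertex becomes a one-point path and an attached vertex is absorbed by an existing
path. The length equation is the count of vertices of a forest as components plus edges. -/
theorem IncMonomial.mem_span_forest {T : List V} {d : ℕ} {x : ArnoldAlgebra K V}
    (hx : IncMonomial K T d x) : x ∈ Submodule.span K {z | ∃ L : List (List V),
      L.flatten.Perm T ∧ (∀ l ∈ L, l ≠ []) ∧ T.length = L.length + d ∧ z = forest K L} := by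
  induction hx with
  | nil => exact Submodule.subset_span ⟨[], by simp [forest]⟩
  | @skip T d x v hx ih =>
    refine Submodule.span_mono ?_ ih
    rintro _ ⟨L, h1, h2, h3, rfl⟩
    refine ⟨[v] :: L, by simpa using h1, by simpa using h2, ?_, by simp [forest_cons, path]⟩
    simp only [List.length_cons, h3]; omega
  | @attach T d x v i hi hx ih =>
    have h := Submodule.mem_map_of_mem (f := LinearMap.mulLeft K (edge K v i)) ih
    rw [Submodule.map_span] at h
    refine Submodule.span_le.2 ?_ h
    rintro _ ⟨_, ⟨L, h1, h2, h3, rfl⟩, rfl⟩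
    refine Submodule.span_mono ?_ (edge_mul_forest_mem_span K v i L (h1.mem_iff.2 hi) h2)
    rintro _ ⟨L', h4, h5, h6, rfl⟩
    refine ⟨L', h4.trans (h1.cons v), h5, ?_, rfl⟩
    simp only [List.length_cons, h3, h6]; omega

theorem IncMonomial.exists_eq_prod {T : List V} {d : ℕ} {x : ArnoldAlgebra K V}
    (hx : IncMonomial K T d x) : ∃ l : List (V × V), l.length = d ∧
      x = (l.map fun e => edge K e.1 e.2).prod := by
  induction hx with
  | nil => exact ⟨[], by simp⟩
  | skip v _ ih => exact ih
  | @attach T d x v i hi hx ih =>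
    obtain ⟨l, rfl, rfl⟩ := ih
    exact ⟨(v, i) :: l, by simp⟩

variable (K)

theorem piece_zero : piece K V 0 = Submodule.span K {1} := by
  rw [piece, ExteriorAlgebra.exteriorPower, pow_zero, Submodule.one_eq_span, Submodule.map_span]
  simp

theorem piece_succ (d : ℕ) : piece K V (d + 1) = piece K V 1 * piece K V d := by
  simp only [piece, ExteriorAlgebra.exteriorPower]
  rw [pow_succ', pow_one, Submodule.map_mul]

theorem piece_one : piece K V 1 = Submodule.span K {z | ∃ i j : V, z = edge K i j} := by
  apply le_antisymm
  · rintro _ ⟨x, hx, rfl⟩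
    rw [SetLike.mem_coe, ExteriorAlgebra.exteriorPower, pow_one] at hx
    obtain ⟨m, rfl⟩ := hx
    induction m using Finsupp.induction_linear with
    | zero => simp
    | add f g hf hg => rw [map_add, map_add]; exact add_mem hf hg
    | single e r =>
      obtain ⟨e, he⟩ := e
      induction e using Sym2.ind with
      | _ i j =>
        rw [← mul_one r, ← smul_eq_mul, ← Finsupp.smul_single, map_smul, map_smul]
        refine Submodule.smul_mem _ _ (Submodule.subset_span ⟨i, j, ?_⟩)
        rw [edge_of_ne K (fun h => he (Sym2.mk_isDiag_iff.2 h))]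
        rfl
  · rw [Submodule.span_le]
    rintro _ ⟨i, j, rfl⟩
    by_cases h : i = j
    · subst h
      simp
    · rw [edge_of_ne K h]
      exact ⟨_, by rw [SetLike.mem_coe, ExteriorAlgebra.exteriorPower, pow_one]; exact ⟨_, rfl⟩, rfl⟩

theorem edge_mem_piece_one (i j : V) : edge K i j ∈ piece K V 1 := by
  rw [piece_one]
  exact Submodule.subset_span ⟨i, j, rfl⟩

theorem prod_edge_mem_piece (l : List (V × V)) :
    (l.map fun e => edge K e.1 e.2).prod ∈ piece K V l.length := by
  induction l with
  | nil => rw [List.map_nil, List.length_nil, piece_zero]; exact Submodule.subset_span rfl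
  | cons e l ih =>
    rw [List.map_cons, List.prod_cons, List.length_cons, piece_succ]
    exact Submodule.mul_mem_mul (edge_mem_piece_one K _ _) ih

theorem piece_le_span_incMonomial (T : List V) (hT : ∀ v, v ∈ T) (d : ℕ) :
    piece K V d ≤ Submodule.span K {z | IncMonomial K T d z} := by
  induction d with
  | zero =>
    rw [piece_zero]
    refine Submodule.span_mono ?_
    rintro _ rfl
    clear hT
    induction T with
    | nil => exact .nil
    | cons v T ih => exact .skip v ih
  | succ d ih =>
    rw [piece_succ, piece_one]
    refine (mul_le_mul' le_rfl ih).trans ?_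
    rw [Submodule.span_mul_span, Submodule.span_le]
    rintro _ ⟨_, ⟨i, j, rfl⟩, x, hx, rfl⟩
    exact IncMonomial.edge_mul_mem_span hx (hT i) (hT j)

end ArnoldAlgebra

/-! ### Functoriality in the vertex set -/

namespace ArnoldAlgebra

variable (K : Type*) {V W : Type*} [CommRing K]

theorem algHom_ext {B : Type*} [Semiring B] [Algebra K B] {f g : ArnoldAlgebra K V →ₐ[K] B}
    (h : ∀ i j, f (edge K i j) = g (edge K i j)) : f = g := by
  apply RingQuot.ringQuot_ext'
  apply ExteriorAlgebra.hom_ext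
  apply Finsupp.lhom_ext'
  rintro ⟨e, he⟩
  induction e using Sym2.ind with
  | _ i j =>
    ext
    have := h i j
    rw [edge_of_ne K (fun h => he (Sym2.mk_isDiag_iff.2 h))] at this
    exact this

/-- The action of an embedding of vertex sets on unordered pairs of distinct elements. -/
def pairMap (g : V ↪ W) (e : ArnoldPair V) : ArnoldPair W :=
  ⟨Sym2.map g e.1, fun h => e.2 ((Sym2.isDiag_map g.injective).1 h)⟩

/-- The map of exterior algebras with `a_{i,j} ↦ a_{g i, g j}`. -/
def mapExterior (g : V ↪ W) : ArnoldExterior K V →ₐ[K] ArnoldExterior K W :=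
  ExteriorAlgebra.map (Finsupp.lmapDomain K K (pairMap g))

theorem mapExterior_gen (g : V ↪ W) (i j : V) (h : i ≠ j) :
    mapExterior K g (ArnoldExterior.gen K i j h)
      = ArnoldExterior.gen K (g i) (g j) (g.injective.ne h) := by
  simp [mapExterior, ArnoldExterior.gen, pairMap, Finsupp.mapDomain_single]

/-- The map of Arnold algebras with `a_{i,j} ↦ a_{g i, g j}`. -/
def mapHom (g : V ↪ W) : ArnoldAlgebra K V →ₐ[K] ArnoldAlgebra K W :=
  RingQuot.liftAlgHom K ⟨(mk K).comp (mapExterior K g), by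
    rintro _ _ ⟨i, j, k, hij, hjk, hki⟩
    simp only [AlgHom.comp_apply, map_add, map_mul, mapExterior_gen, map_zero]
    have h := RingQuot.mkAlgHom_rel K (ArnoldRel.arnold (K := K) (g i) (g j) (g k)
      (g.injective.ne hij) (g.injective.ne hjk) (g.injective.ne hki))
    simp only [map_add, map_mul, map_zero] at h
    exact h⟩

theorem mapHom_edge (g : V ↪ W) (i j : V) :
    mapHom K g (edge K i j) = edge K (g i) (g j) := by
  by_cases h : i = j
  · simp [h]
  rw [edge_of_ne K h, edge_of_ne K (g.injective.ne h), ← mapExterior_gen]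
  exact RingQuot.liftAlgHom_mkAlgHom_apply K _ _ _

theorem permHom_edge (σ : Equiv.Perm V) (i j : V) :
    permHom K σ (edge K i j) = edge K (σ i) (σ j) := by
  by_cases h : i = j
  · simp [h]
  rw [edge_of_ne K h, edge_of_ne K (σ.injective.ne h), ← permExterior_gen]
  exact permHom_mk K _ _

theorem permHom_path (σ : Equiv.Perm V) : ∀ l : List V,
    permHom K σ (path K l) = path K (l.map σ)
  | [] => by simp [path]
  | [_] => by simp [path]
  | x :: y :: l => by
    have := permHom_path σ (y :: l)
    simp only [path, map_mul, permHom_edge, this, List.map_cons]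

theorem permHom_forest (σ : Equiv.Perm V) (L : List (List V)) :
    permHom K σ (forest K L) = forest K (L.map (List.map σ)) := by
  induction L with
  | nil => simp [forest]
  | cons l L ih => simp only [forest_cons, map_mul, permHom_path, ih, List.map_cons]

theorem mapHom_mem_piece (g : V ↪ W) (d : ℕ) {x : ArnoldAlgebra K V} (hx : x ∈ piece K V d) :
    mapHom K g x ∈ piece K W d := by
  suffices h : (piece K V d).map (mapHom K g).toLinearMap ≤ piece K W d from h ⟨x, hx, rfl⟩
  clear hx
  induction d with
  | zero => simp [piece_zero, Submodule.map_span]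
  | succ d ih =>
    rw [piece_succ K d, piece_succ K d, Submodule.map_mul]
    refine mul_le_mul' ?_ ih
    rw [piece_one, Submodule.map_span, Submodule.span_le]
    rintro _ ⟨_, ⟨i, j, rfl⟩, rfl⟩
    rw [AlgHom.toLinearMap_apply, mapHom_edge]
    exact edge_mem_piece_one K _ _

theorem path_mem_piece : ∀ l : List V, path K l ∈ piece K V (l.length - 1)
  | [] => by simp [path, piece_zero]
  | [_] => by simp [path, piece_zero]
  | x :: y :: l => by
    have := Submodule.mul_mem_mul (edge_mem_piece_one K x y) (path_mem_piece (y :: l))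
    rw [← piece_succ] at this
    exact this

theorem piece_mul_le (d e : ℕ) : piece K V d * piece K V e ≤ piece K V (d + e) := by
  induction d with
  | zero => simp [piece_zero, ← Submodule.one_eq_span]
  | succ d ih =>
    rw [piece_succ K d, mul_assoc, Nat.add_right_comm, piece_succ K (d + e)]
    exact mul_le_mul' le_rfl ih

theorem forest_mem_piece (L : List (List V)) :
    forest K L ∈ piece K V (L.map fun l => l.length - 1).sum := by
  induction L with
  | nil => simp [forest, piece_zero]
  | cons l L ih =>
    rw [forest_cons, List.map_cons, List.sum_cons]
    exact piece_mul_le K _ _ (Submodule.mul_mem_mul (path_mem_piece K l) ih)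

/-- The map of graded pieces with `a_{i,j} ↦ a_{g i, g j}`. -/
def pieceMap (g : V ↪ W) (d : ℕ) : piece K V d →ₗ[K] piece K W d :=
  (mapHom K g).toLinearMap.restrict fun _ => mapHom_mem_piece K g d

theorem pieceMap_pieceRep (g : V ↪ W) (d : ℕ) (σ : Equiv.Perm V) (x : piece K V d) :
    pieceMap K g d (pieceRep K V d σ x)
      = pieceRep K W d (σ.viaEmbedding g) (pieceMap K g d x) := by
  apply Subtype.ext
  have : (mapHom K g).comp (permHom K σ) = (permHom K (σ.viaEmbedding g)).comp (mapHom K g) :=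
    algHom_ext K fun i j => by
      simp [permHom_edge, mapHom_edge, Equiv.Perm.viaEmbedding_apply]
  exact DFunLike.congr_fun this (x : ArnoldAlgebra K V)


instance finite_piece [Finite V] (d : ℕ) : Module.Finite K (piece K V d) := by
  unfold piece
  infer_instance

end ArnoldAlgebra

/-! ### Coinvariants of labelled elements -/

section Labelled

open Representation

variable {K V W M N : Type*} (Y : Type*) [CommRing K] [AddCommGroup M] [Module K M]
  [AddCommGroup N] [Module K N]

variable {Y} in
/-- The linear map that acts by `φ` on the labels and by `ψ` on the coefficients. -/
def labelMap (φ : (Y → V) → (Y → W)) (ψ : M →ₗ[K] N) : ((Y → V) →₀ M) →ₗ[K] ((Y → W) →₀ N) :=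
  Finsupp.lmapDomain N K φ ∘ₗ Finsupp.mapRange.linearMap ψ

variable {Y} in
@[simp] theorem labelMap_single (φ : (Y → V) → (Y → W)) (ψ : M →ₗ[K] N) (f : Y → V) (x : M) :
    labelMap φ ψ (Finsupp.single f x) = Finsupp.single (φ f) (ψ x) := by
  simp [labelMap]

/-- The diagonal action of the permutations of `V` on a representation tensored with the span of
the functions `Y → V`. -/
def labelledRep (ρ : Representation K (Equiv.Perm V) M) :
    Representation K (Equiv.Perm V) ((Y → V) →₀ M) where
  toFun σ := labelMap (fun f => σ ∘ f) (ρ σ)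
  map_one' := by
    ext f x : 2
    simp
  map_mul' σ τ := by
    ext f x : 2
    simp [Function.comp_assoc]

/-- The coinvariants of the permutations of `V`. -/
abbrev LabelledCoinv (ρ : Representation K (Equiv.Perm V) M) : Type _ :=
  (labelledRep Y ρ).Coinvariants

variable {Y} (ρ : Representation K (Equiv.Perm V) M) (τ : Representation K (Equiv.Perm W) N)

/-- The class of a labelled element. -/
def labelledMk (f : Y → V) (x : M) : LabelledCoinv Y ρ :=
  Coinvariants.mk (labelledRep Y ρ) (Finsupp.single f x)

theorem labelledRep_single (σ : Equiv.Perm V) (f : Y → V) (x : M) :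
    labelledRep Y ρ σ (Finsupp.single f x) = Finsupp.single (σ ∘ f) (ρ σ x) :=
  labelMap_single _ _ _ _

theorem labelledMk_perm (σ : Equiv.Perm V) (f : Y → V) (x : M) :
    labelledMk ρ (σ ∘ f) (ρ σ x) = labelledMk ρ f x := by
  rw [labelledMk, labelledMk, ← labelledRep_single, Coinvariants.mk_self_apply]

variable {ρ} in
theorem labelledCoinv_eq_top {s : Set M} (hs : Submodule.span K s = ⊤)
    {L : Submodule K (LabelledCoinv Y ρ)} (h : ∀ (f : Y → V), ∀ x ∈ s, labelledMk ρ f x ∈ L) :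
    L = ⊤ := by
  have key : ∀ (f : Y → V) (x : M), labelledMk ρ f x ∈ L := by
    intro f x
    have hx : x ∈ Submodule.span K s := hs ▸ Submodule.mem_top
    induction hx using Submodule.span_induction with
    | mem y hy => exact h f y hy
    | zero =>
      rw [labelledMk, Finsupp.single_zero, map_zero]
      exact L.zero_mem
    | add y z _ _ hy hz =>
      rw [labelledMk, Finsupp.single_add, map_add]
      exact L.add_mem hy hz
    | smul r y _ hy =>
      rw [labelledMk, ← Finsupp.smul_single, map_smul]
      exact L.smul_mem r hy
  rw [eq_top_iff]
  rintro q -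
  induction q using Coinvariants.induction_on with
  | h u =>
    induction u using Finsupp.induction_linear with
    | zero => rw [map_zero]; exact L.zero_mem
    | add u v hu hv => rw [map_add]; exact L.add_mem hu hv
    | single f x => exact key f x

theorem labelMap_comp_comm (c : Y → Y) (σ : Equiv.Perm V) :
    labelMap (fun f => f ∘ c) LinearMap.id ∘ₗ labelledRep Y ρ σ
      = labelledRep Y ρ σ ∘ₗ labelMap (fun f => f ∘ c) LinearMap.id := by
  ext f x : 2
  simp [labelledRep_single, Function.comp_assoc]

/-- Reindexing of the labels by `c`. -/
def relabel (c : Y → Y) : IntertwiningMap (labelledRep Y ρ) (labelledRep Y ρ) :=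
  ⟨labelMap (fun f => f ∘ c) LinearMap.id, labelMap_comp_comm ρ c⟩

/-- Reindexing of the labels by `c`, on coinvariants. -/
def relabelCoinv (c : Y → Y) : LabelledCoinv Y ρ →ₗ[K] LabelledCoinv Y ρ :=
  Coinvariants.map _ _ (relabel ρ c)

theorem relabelCoinv_mk (c : Y → Y) (f : Y → V) (x : M) :
    relabelCoinv ρ c (labelledMk ρ f x) = labelledMk ρ (f ∘ c) x := by
  rw [relabelCoinv, labelledMk, Coinvariants.map_mk, labelledMk]
  congr 1
  exact labelMap_single _ _ _ _

variable {ρ} in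
theorem labelledCoinv_hom_ext {X : Type*} [AddCommGroup X] [Module K X]
    {φ ψ : LabelledCoinv Y ρ →ₗ[K] X}
    (h : ∀ f x, φ (labelledMk ρ f x) = ψ (labelledMk ρ f x)) : φ = ψ := by
  ext f x
  exact h f x

theorem relabelCoinv_pow (c : Y → Y) (k : ℕ) :
    relabelCoinv ρ c ^ k = relabelCoinv ρ c^[k] := by
  induction k with
  | zero =>
    refine labelledCoinv_hom_ext fun f x => ?_
    simp [relabelCoinv_mk]
  | succ k ih =>
    refine labelledCoinv_hom_ext fun f x => ?_
    rw [pow_succ, Module.End.mul_apply, relabelCoinv_mk, ih, relabelCoinv_mk, relabelCoinv_mk,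
      Function.comp_assoc, ← Function.iterate_succ']

/-- Finite order makes the eigenvalues roots of unity, which is how the trace gets bounded by the
dimension. -/
theorem relabelCoinv_pow_orderOf (c : Equiv.Perm Y) : relabelCoinv ρ c ^ orderOf c = 1 := by
  rw [relabelCoinv_pow, Equiv.Perm.iterate_eq_pow, pow_orderOf_eq_one]
  refine labelledCoinv_hom_ext fun f x => ?_
  simp [relabelCoinv_mk]

variable {ρ τ} (Y) in
/-- The map of coinvariants induced by an embedding of the vertex sets and a compatible map of
representations. -/
def coinvMap (g : V ↪ W) (φ : M →ₗ[K] N)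
    (hφ : ∀ σ x, φ (ρ σ x) = τ (σ.viaEmbedding g) (φ x)) :
    LabelledCoinv Y ρ →ₗ[K] LabelledCoinv Y τ :=
  Coinvariants.lift _ (Coinvariants.mk (labelledRep Y τ) ∘ₗ labelMap (fun f => g ∘ f) φ)
    fun σ => by
      ext f x : 2
      have hf : (g ∘ σ ∘ f : Y → W) = σ.viaEmbedding g ∘ g ∘ f := by
        ext y
        simp [Equiv.Perm.viaEmbedding_apply]
      have := labelledMk_perm τ (σ.viaEmbedding g) (g ∘ f) (φ x)
      rw [← hf, ← hφ] at this
      simpa [labelledRep_single, labelledMk] using this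

variable {ρ τ} in
theorem coinvMap_mk (g : V ↪ W) (φ : M →ₗ[K] N)
    (hφ : ∀ σ x, φ (ρ σ x) = τ (σ.viaEmbedding g) (φ x)) (f : Y → V) (x : M) :
    coinvMap Y g φ hφ (labelledMk ρ f x) = labelledMk τ (g ∘ f) (φ x) := by
  simp [coinvMap, labelledMk]

variable {ρ τ} in
theorem coinvMap_relabelCoinv (g : V ↪ W) (φ : M →ₗ[K] N)
    (hφ : ∀ σ x, φ (ρ σ x) = τ (σ.viaEmbedding g) (φ x)) (c : Y → Y) :
    coinvMap Y g φ hφ ∘ₗ relabelCoinv ρ c = relabelCoinv τ c ∘ₗ coinvMap Y g φ hφ := by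
  refine labelledCoinv_hom_ext fun f x => ?_
  simp [relabelCoinv_mk, coinvMap_mk, Function.comp_assoc]

end Labelled

/-! ### Traces: on coinvariants, of finite order, and along surjections -/

section Trace

open Representation

/-- The map sends the copy of `M` at `f` to the copy at `φ f`, so only fixed labels contribute
diagonal blocks, each with the trace of `ψ`. -/
theorem trace_labelMap {K V M Y : Type*} [Field K] [AddCommGroup M] [Module K M]
    [Module.Finite K M] [Fintype (Y → V)] [DecidableEq (Y → V)]
    (φ : (Y → V) → (Y → V)) (ψ : M →ₗ[K] M) :
    LinearMap.trace K ((Y → V) →₀ M) (labelMap φ ψ)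
      = (Finset.univ.filter fun f => φ f = f).card * LinearMap.trace K M ψ := by
  classical
  let b := Module.finBasis K M
  rw [LinearMap.trace_eq_matrix_trace K (Finsupp.basis fun _ : Y → V => b),
    LinearMap.trace_eq_matrix_trace K b, Matrix.trace, Fintype.sum_sigma, Matrix.trace,
    Finset.card_filter, Nat.cast_sum, Finset.sum_mul]
  refine Finset.sum_congr rfl fun f _ => ?_
  simp only [Matrix.diag_apply, LinearMap.toMatrix_apply, Finsupp.coe_basis, labelMap_single,
    Finsupp.basis_repr, Finsupp.single_apply]
  split_ifs with h <;> simp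

/-- The averaging operator `p` factors through the coinvariants as a section `s` of the projection.
Thus the induced map is projection, `c` and `s` composed, and cyclicity of the trace turns it into
the trace of `p ∘ c` on `U`. -/
theorem trace_coinvariants_map {K G U : Type*} [Field K] [CharZero K] [Group G] [Fintype G]
    [AddCommGroup U] [Module K U] [Module.Finite K U] (ρ : Representation K G U)
    (c : IntertwiningMap ρ ρ) :
    LinearMap.trace K ρ.Coinvariants (Coinvariants.map ρ ρ c)
      = (Fintype.card G : K)⁻¹ * ∑ g, LinearMap.trace K U (ρ g ∘ₗ c.toLinearMap) := by
  let p : U →ₗ[K] U := (Fintype.card G : K)⁻¹ • ∑ g, ρ g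
  have hp : ∀ h : G, p ∘ₗ ρ h = p := by
    intro h
    ext x
    simp only [p, LinearMap.comp_apply, LinearMap.smul_apply, LinearMap.sum_apply]
    congr 1
    refine Fintype.sum_equiv (Equiv.mulRight h) _ _ fun g => ?_
    simp
  let s : ρ.Coinvariants →ₗ[K] U := Coinvariants.lift ρ p hp
  have hs : Coinvariants.mk ρ ∘ₗ s = LinearMap.id := by
    ext x
    simp [s, p, ← Nat.cast_smul_eq_nsmul K, smul_smul]
  have hc : Coinvariants.map ρ ρ c = (Coinvariants.mk ρ ∘ₗ c.toLinearMap) ∘ₗ s := by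
    have : Coinvariants.mk ρ ∘ₗ c.toLinearMap = Coinvariants.map ρ ρ c ∘ₗ Coinvariants.mk ρ := rfl
    rw [this, LinearMap.comp_assoc, hs, LinearMap.comp_id]
  rw [hc, LinearMap.trace_comp_comm', ← LinearMap.comp_assoc, Coinvariants.lift_comp_mk]
  have : (∑ g, ρ g) ∘ₗ c.toLinearMap = ∑ g, ρ g ∘ₗ c.toLinearMap := by
    ext x
    simp
  simp only [p, LinearMap.smul_comp, this, map_smul, map_sum, smul_eq_mul]

/-- After base change to `ℂ` the trace is a sum of at most `finrank` eigenvalues, all of them roots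
of unity. -/
theorem norm_trace_le_finrank {K : Type*} [Field K] [Algebra K ℂ] {U : Type*} [AddCommGroup U] [Module K U]
    [Module.Finite K U] (T : Module.End K U) {k : ℕ} (hk : k ≠ 0) (hT : T ^ k = 1) :
    ‖algebraMap K ℂ (LinearMap.trace K U T)‖ ≤ Module.finrank K U := by
  have h1 : algebraMap K ℂ (LinearMap.trace K U T)
      = LinearMap.trace ℂ (TensorProduct K ℂ U) (T.baseChange ℂ) :=
    (LinearMap.trace_baseChange T ℂ).symm
  have hT' : (T.baseChange ℂ : Module.End ℂ (TensorProduct K ℂ U)) ^ k = 1 := by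
    rw [← LinearMap.baseChange_pow, hT]
    exact LinearMap.baseChange_id
  have h2 : ∀ z ∈ (LinearMap.charpoly (T.baseChange ℂ)).roots, ‖z‖ ≤ 1 := by
    intro z hz
    have hz' := (Polynomial.mem_roots'.1 hz).2
    rw [← Module.End.hasEigenvalue_iff_isRoot_charpoly] at hz'
    obtain ⟨v, hv⟩ := hz'.exists_hasEigenvector
    have h3 := hv.pow_apply k
    rw [hT', Module.End.one_apply] at h3
    have h4 : z ^ k = 1 := by
      have : (z ^ k - 1) • v = 0 := by rw [sub_smul, ← h3, one_smul, sub_self]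
      exact sub_eq_zero.1 ((smul_eq_zero.1 this).resolve_right hv.2)
    exact (Complex.norm_eq_one_of_pow_eq_one h4 hk).le
  rw [h1, Module.End.trace_eq_sum_roots_charpoly_of_splits (IsAlgClosed.splits _)]
  refine (norm_multiset_sum_le _).trans ?_
  refine (Multiset.sum_le_card_nsmul _ 1 ?_).trans ?_
  · intro x hx
    obtain ⟨z, hz, rfl⟩ := Multiset.mem_map.1 hx
    exact h2 z hz
  · rw [Multiset.card_map, nsmul_eq_mul, mul_one, Nat.cast_le]
    refine (Polynomial.card_roots' _).trans ?_
    rw [LinearMap.charpoly_natDegree, Module.finrank_baseChange]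

/-- Surjections make the dimensions decrease from `a` on, hence stabilise; then each `φ n` is an
isomorphism conjugating `T n` to `T (n + 1)`. The stage `b` is not explicit, so the dimension is
bounded by its value at the explicit stage `a`. -/
theorem exists_trace_eventually_eq {K : Type*} [Field K] (Q : ℕ → Type*)
    [∀ n, AddCommGroup (Q n)] [∀ n, Module K (Q n)] [∀ n, Module.Finite K (Q n)]
    (T : ∀ n, Module.End K (Q n)) (φ : ∀ n, Q n →ₗ[K] Q (n + 1))
    (hφ : ∀ n, φ n ∘ₗ T n = T (n + 1) ∘ₗ φ n) (a : ℕ)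
    (hs : ∀ n, a ≤ n → Function.Surjective (φ n)) :
    ∃ b, a ≤ b ∧ ∀ n, b ≤ n → LinearMap.trace K (Q n) (T n) = LinearMap.trace K (Q b) (T b) ∧
      Module.finrank K (Q n) ≤ Module.finrank K (Q a) := by
  have hanti : Antitone fun n => Module.finrank K (Q (a + n)) :=
    antitone_nat_of_succ_le fun n =>
      LinearMap.finrank_le_finrank_of_surjective (hs (a + n) (Nat.le_add_right a n))
  obtain ⟨m, hm⟩ := WellFoundedGT.monotone_chain_condition
    (⟨fun n => OrderDual.toDual (Module.finrank K (Q (a + n))), fun i j h => hanti h⟩ : ℕ →o ℕᵒᵈ)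
  refine ⟨a + m, Nat.le_add_right a m, fun n hn => ⟨?_, ?_⟩⟩
  · induction n, hn using Nat.le_induction with
    | base => rfl
    | succ n hn ih =>
      rw [← ih]
      have hdim : ∀ k, a + m ≤ k → Module.finrank K (Q k) = Module.finrank K (Q (a + m)) := by
        intro k hk
        obtain ⟨j, rfl⟩ := Nat.exists_eq_add_of_le ((Nat.le_add_right a m).trans hk)
        exact (hm j (by omega)).symm
      have hbij : Function.Bijective (φ n) :=
        ⟨(LinearMap.injective_iff_surjective_of_finrank_eq_finrank
          ((hdim n hn).trans (hdim (n + 1) (by omega)).symm)).2 (hs n (by omega)),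
          hs n (by omega)⟩
      rw [← LinearMap.trace_conj' (T n) (LinearEquiv.ofBijective (φ n) hbij)]
      congr 1
      ext x
      obtain ⟨y, rfl⟩ := hbij.2 x
      rw [LinearEquiv.conj_apply_apply]
      have : (LinearEquiv.ofBijective (φ n) hbij).symm (φ n y) = y :=
        (LinearEquiv.ofBijective (φ n) hbij).symm_apply_apply y
      rw [this]
      exact (LinearMap.congr_fun (hφ n) y).symm
  · obtain ⟨j, rfl⟩ := Nat.exists_eq_add_of_le ((Nat.le_add_right a m).trans hn)
    exact hanti (Nat.zero_le j)

end Trace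

/-! ### Stabilisation and dimension bound for the Arnold coinvariants -/

theorem span_coe_preimage_eq_top {R M : Type*} [Semiring R] [AddCommMonoid M] [Module R M]
    {p : Submodule R M} {s : Set M} (h : s ⊆ p) (hs : p ≤ Submodule.span R s) :
    Submodule.span R ((↑) ⁻¹' s : Set p) = ⊤ := by
  obtain rfl : Submodule.span R s = p := le_antisymm (Submodule.span_le.2 h) hs
  exact Submodule.span_span_coe_preimage

namespace ArnoldAlgebra

variable (K : Type*) [Field K] (Y : Type*) [Fintype Y]

/-- The coinvariants of the permutations on the labelled elements of degree `d`. -/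
abbrev ArnoldCoinv (V : Type*) (d : ℕ) : Type _ :=
  LabelledCoinv Y (pieceRep K V d)

/-- The map of coinvariants induced by an embedding of the vertex sets. -/
def arnoldCoinvMap {V W : Type*} (g : V ↪ W) (d : ℕ) :
    ArnoldCoinv K Y V d →ₗ[K] ArnoldCoinv K Y W d :=
  coinvMap Y g (pieceMap K g d) (pieceMap_pieceRep K g d)

/-- The edges and labels meet at most `2 * d + |Y|` of the `n + 1` vertices. Swapping a free vertex
with the last one preserves the class in the coinvariants and leaves an element supported on the
first `n` vertices. -/
theorem arnoldCoinvMap_castSucc_surjective {n d : ℕ} (h : 2 * d + Fintype.card Y ≤ n) :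
    Function.Surjective (arnoldCoinvMap K Y (Fin.castSuccEmb (n := n)) d) := by
  classical
  rw [← LinearMap.range_eq_top]
  let s : Set (ArnoldAlgebra K (Fin (n + 1))) := {z | ∃ l : List (Fin (n + 1) × Fin (n + 1)),
    l.length = d ∧ z = (l.map fun e => edge K e.1 e.2).prod}
  have hs : s ⊆ piece K (Fin (n + 1)) d := by
    rintro _ ⟨l, rfl, rfl⟩
    exact prod_edge_mem_piece K l
  have hs' : piece K (Fin (n + 1)) d ≤ Submodule.span K s := by
    refine (piece_le_span_incMonomial K (List.finRange (n + 1)) (List.mem_finRange) d).trans ?_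
    exact Submodule.span_mono fun z hz => hz.exists_eq_prod
  refine labelledCoinv_eq_top (span_coe_preimage_eq_top hs hs') ?_
  rintro f ⟨_, hx⟩ ⟨l, hl, rfl⟩
  -- a vertex that carries neither an edge nor a label
  obtain ⟨v, hv⟩ : ∃ v, v ∉ (l.map Prod.fst).toFinset ∪ (l.map Prod.snd).toFinset ∪
      Finset.univ.image f := by
    by_contra! hcon
    have h1 := Finset.card_le_card (fun v _ => hcon v : (Finset.univ : Finset (Fin (n + 1))) ⊆ _)
    have h2 := (Finset.card_union_le ((l.map Prod.fst).toFinset ∪ (l.map Prod.snd).toFinset)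
      (Finset.univ.image f))
    have h3 := Finset.card_union_le (l.map Prod.fst).toFinset (l.map Prod.snd).toFinset
    have h4 := (l.map Prod.fst).toFinset_card_le
    have h5 := (l.map Prod.snd).toFinset_card_le
    have h6 := Finset.card_image_le (s := Finset.univ) (f := f)
    simp only [List.length_map, Finset.card_univ, Fintype.card_fin] at h1 h4 h5 h6
    omega
  simp only [Finset.mem_union, List.mem_toFinset, List.mem_map, Finset.mem_image, Finset.mem_univ,
    true_and, not_or, not_exists, not_and] at hv
  obtain ⟨⟨hv1, hv2⟩, hv3⟩ := hv
  let σ := Equiv.swap v (Fin.last n)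
  have hσ : ∀ u, u ≠ v → σ u ≠ Fin.last n := by
    intro u hu h
    exact hu (σ.injective (h.trans (Equiv.swap_apply_left v (Fin.last n)).symm))
  have hσ' : ∀ u, u ≠ v → ∃ w : Fin n, w.castSucc = σ u := fun u hu =>
    ⟨(σ u).castPred (hσ u hu), Fin.castSucc_castPred _ _⟩
  choose f' hf' using fun y => hσ' (f y) (hv3 y)
  obtain ⟨l', hl'⟩ : l.map (Prod.map σ σ) ∈
      Set.range (List.map (Prod.map (Fin.castSuccEmb (n := n)) (Fin.castSuccEmb (n := n)))) := by
    rw [Set.range_list_map]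
    intro e' he'
    obtain ⟨e, he, rfl⟩ := List.mem_map.1 he'
    obtain ⟨a, ha⟩ := hσ' e.1 (hv1 e he)
    obtain ⟨b, hb⟩ := hσ' e.2 (hv2 e he)
    exact ⟨(a, b), by simp [ha, hb, Prod.map]⟩
  have hd : l'.length = d := by
    have := congrArg List.length hl'
    simpa [hl] using this
  subst hd
  refine ⟨labelledMk _ f' ⟨_, prod_edge_mem_piece K l'⟩, ?_⟩
  rw [arnoldCoinvMap, coinvMap_mk, ← labelledMk_perm (pieceRep K _ _) σ f]
  congr 1
  · ext y
    simp [← hf']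
  · apply Subtype.ext
    change mapHom K _ (l'.map fun e => edge K e.1 e.2).prod
      = permHom K σ (l.map fun e => edge K e.1 e.2).prod
    rw [map_list_prod, map_list_prod, List.map_map, List.map_map]
    have h1 : (mapHom K (Fin.castSuccEmb (n := n))) ∘ (fun e : Fin n × Fin n => edge K e.1 e.2)
        = (fun e => edge K e.1 e.2) ∘ Prod.map Fin.castSuccEmb Fin.castSuccEmb := by
      ext e
      exact mapHom_edge K _ _ _
    have h2 : (permHom K σ) ∘ (fun e : Fin (n + 1) × Fin (n + 1) => edge K e.1 e.2)
        = (fun e => edge K e.1 e.2) ∘ Prod.map σ σ := by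
      ext e
      exact permHom_edge K _ _ _
    rw [h1, h2, ← List.map_map, hl', List.map_map]

theorem exists_perm_map_eq {V : Type*} {l l' : List V} (h : l.Nodup) (h' : l'.Nodup)
    (hl : l.length = l'.length) : ∃ σ : Equiv.Perm V, l.map σ = l'  := by
  have := Equiv.Perm.isMultiplyPretransitive V l.length
  obtain ⟨σ, hσ⟩ := MulAction.exists_smul_eq (Equiv.Perm V)
    (⟨l.get, h.injective_get⟩ : Fin l.length ↪ V)
    (⟨fun i => l'.get (i.cast hl), fun i j hij => by simpa using h'.injective_get hij⟩ :
      Fin l.length ↪ V)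
  refine ⟨σ, List.ext_get (by simpa using hl) fun n h1 h2 => ?_⟩
  have := DFunLike.congr_fun hσ ⟨n, by simpa using h1⟩
  simpa using this

/-- Edge numbers of the nontrivial paths in a list of paths. -/
def edgeNumbers {V : Type*} (L : List (List V)) : List ℕ :=
  (L.map fun l => l.length - 1).filter (· ≠ 0)

theorem edgeNumbers_sum {V : Type*} (L : List (List V)) (hL : ∀ l ∈ L, l ≠ []) :
    (edgeNumbers L).sum + L.length = L.flatten.length := by
  induction L with
  | nil => simp [edgeNumbers]
  | cons l L ih =>
    have h1 := ih fun l hl => hL l (by simp [hl])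
    have h2 : 0 < l.length := List.length_pos_iff.2 (hL l (by simp))
    simp only [edgeNumbers, List.map_cons, List.filter_cons, List.length_cons,
      List.flatten_cons, List.length_append] at h1 ⊢
    split_ifs with h
    · rw [List.sum_cons]
      omega
    · have h3 : l.length - 1 = 0 := by simpa using h
      omega

/-- The nontrivial paths. -/
def nontrivialPaths {V : Type*} (L : List (List V)) : List (List V) :=
  L.filter fun l => l.length - 1 ≠ 0

theorem forest_nontrivialPaths {V : Type*} (L : List (List V)) :
    forest K (nontrivialPaths L) = forest K L := by
  induction L with
  | nil => rfl
  | cons l L ih =>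
    rw [nontrivialPaths, List.filter_cons]
    split_ifs with h
    · rw [forest_cons, forest_cons, ← ih, nontrivialPaths]
    · rw [forest_cons, ← ih, nontrivialPaths]
      match l, h with
      | [], _ => simp [path]
      | [_], _ => simp [path]
      | _ :: _ :: _, h => simp at h

theorem map_length_nontrivialPaths {V : Type*} (L : List (List V)) :
    (nontrivialPaths L).map List.length = (edgeNumbers L).map (· + 1) := by
  rw [nontrivialPaths, edgeNumbers, List.filter_map, List.map_map]
  refine List.map_congr_left fun l hl => ?_
  have := (List.mem_filter.1 hl).2
  simp at this
  simp
  omega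

/-- One-point paths contribute the factor `1` and can be dropped, wherever they stand in the lists.
The remaining paths have equal lengths in order, and a permutation matches their vertices one by
one. -/
theorem exists_perm_forest_eq {V : Type*} {L L' : List (List V)} (h : L.flatten.Nodup)
    (h' : L'.flatten.Nodup) (hL : edgeNumbers L = edgeNumbers L') :
    ∃ σ : Equiv.Perm V, permHom K σ (forest K L) = forest K L' := by
  have hsub : ∀ L : List (List V), L.flatten.Nodup → (nontrivialPaths L).flatten.Nodup :=
    fun L h => h.sublist (List.filter_sublist.flatten)
  have hlen : (nontrivialPaths L).map List.length = (nontrivialPaths L').map List.length := by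
    rw [map_length_nontrivialPaths, map_length_nontrivialPaths, hL]
  obtain ⟨σ, hσ⟩ := exists_perm_map_eq (hsub L h) (hsub L' h')
    (by rw [List.length_flatten, List.length_flatten, hlen])
  refine ⟨σ, ?_⟩
  rw [← forest_nontrivialPaths K L, ← forest_nontrivialPaths K L', permHom_forest]
  congr 1
  rw [List.eq_iff_flatten_eq, ← List.map_flatten, hσ, List.map_map, ← hlen]
  refine ⟨rfl, List.map_congr_left fun l _ => by simp⟩

/-- Modulo permutations one forest per composition of `d` is enough, with arbitrary labels.
Reordering the paths is not used: the count of compositions is already small enough. -/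
theorem finrank_arnoldCoinv_le (n d : ℕ) :
    Module.finrank K (ArnoldCoinv K Y (Fin n) d) ≤ 2 ^ d * n ^ Fintype.card Y := by
  classical
  let T := List.finRange n
  let good : List (List (Fin n)) → Prop := fun L =>
    L.flatten.Perm T ∧ (∀ l ∈ L, l ≠ []) ∧ T.length = L.length + d
  have hsum : ∀ L, good L → (edgeNumbers L).sum = d := by
    rintro L ⟨h1, h2, h3⟩
    have h4 := edgeNumbers_sum L h2
    have h5 := h1.length_eq
    omega
  have hpiece : ∀ L, good L → forest K L ∈ piece K (Fin n) d := by
    intro L hL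
    have h1 := forest_mem_piece K (nontrivialPaths L)
    have h2 : ((nontrivialPaths L).map fun l => l.length - 1) = edgeNumbers L := by
      rw [nontrivialPaths, edgeNumbers, List.filter_map]
      rfl
    rwa [forest_nontrivialPaths, h2, hsum L hL] at h1
  have hnodup : ∀ L, good L → L.flatten.Nodup := fun L hL =>
    hL.1.nodup_iff.2 (List.nodup_finRange n)
  -- The value `0` is for compositions that no forest on `n` vertices realises.
  let v : Composition d × (Y → Fin n) → ArnoldCoinv K Y (Fin n) d := fun bf =>
    if h : ∃ L, good L ∧ edgeNumbers L = bf.1.blocks then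
      labelledMk _ bf.2 ⟨forest K h.choose, hpiece _ h.choose_spec.1⟩
    else 0
  have hv : Submodule.span K (Set.range v) = ⊤ := by
    let s : Set (ArnoldAlgebra K (Fin n)) := {z | ∃ L, good L ∧ z = forest K L}
    have hs : s ⊆ piece K (Fin n) d := by
      rintro _ ⟨L, hL, rfl⟩
      exact hpiece L hL
    have hs' : piece K (Fin n) d ≤ Submodule.span K s := by
      refine (piece_le_span_incMonomial K T List.mem_finRange d).trans ?_
      rw [Submodule.span_le]
      intro z hz
      refine Submodule.span_mono ?_ (IncMonomial.mem_span_forest hz)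
      rintro _ ⟨L, h1, h2, h3, rfl⟩
      exact ⟨L, ⟨h1, h2, h3⟩, rfl⟩
    refine labelledCoinv_eq_top (span_coe_preimage_eq_top hs hs') ?_
    rintro f ⟨_, hx⟩ ⟨L, hL, rfl⟩
    let b : Composition d := ⟨edgeNumbers L, by
      intro i hi
      simp only [edgeNumbers, List.mem_filter, decide_eq_true_eq] at hi
      omega, hsum L hL⟩
    have hex : ∃ L', good L' ∧ edgeNumbers L' = b.blocks := ⟨L, hL, rfl⟩
    obtain ⟨σ, hσ⟩ := exists_perm_forest_eq K (hnodup L hL) (hnodup _ hex.choose_spec.1)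
      hex.choose_spec.2.symm
    -- Moving the forest to the chosen representative by `σ` also moves the labels.
    refine Submodule.subset_span ⟨(b, σ ∘ f), ?_⟩
    simp only [v]
    rw [dif_pos hex, ← labelledMk_perm (pieceRep K _ _) σ f]
    congr 1
    exact Subtype.ext hσ.symm
  refine (finrank_le_of_span_eq_top hv).trans ?_
  rw [Fintype.card_prod, composition_card, Fintype.card_fun, Fintype.card_fin]
  exact Nat.mul_le_mul_right _ (Nat.pow_le_pow_right (by norm_num) (Nat.sub_le d 1))

end ArnoldAlgebra

/-! ### Counting the labelings fixed by a permutation -/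

section LabelFix

variable {Y Z V : Type*} [Fintype Y] [Fintype Z] [Fintype V]

open Classical in
/-- The number of the functions `f : Y → V` with `σ ∘ f ∘ c = f`. -/
def labelFix (c : Equiv.Perm Y) (σ : Equiv.Perm V) : ℕ :=
  (Finset.univ.filter fun f : Y → V => σ ∘ f ∘ c = f).card

theorem labelFix_eq_card (c : Equiv.Perm Y) (σ : Equiv.Perm V) :
    labelFix c σ = Nat.card {f : Y → V // σ ∘ f ∘ c = f} := by
  classical
  rw [Nat.card_eq_fintype_card, Fintype.card_subtype, labelFix]

theorem labelFix_permCongr (e : Y ≃ Z) (c : Equiv.Perm Y) (σ : Equiv.Perm V) :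
    labelFix (e.permCongr c) σ = labelFix c σ := by
  rw [labelFix_eq_card, labelFix_eq_card]
  refine (Nat.card_congr ((Equiv.arrowCongr e (Equiv.refl V)).subtypeEquiv fun f => ?_)).symm
  simp only [funext_iff, Function.comp_apply, Equiv.permCongr_apply, Equiv.arrowCongr_apply,
    Equiv.coe_refl, id, Equiv.symm_apply_apply]
  exact ⟨fun h y => h _, fun h y => by simpa using h (e y)⟩

theorem labelFix_sumCongr (c : Equiv.Perm Y) (c' : Equiv.Perm Z) (σ : Equiv.Perm V) :
    labelFix (Equiv.Perm.sumCongr c c') σ = labelFix c σ * labelFix c' σ := by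
  rw [labelFix_eq_card, labelFix_eq_card, labelFix_eq_card, ← Nat.card_prod]
  refine Nat.card_congr (((Equiv.sumArrowEquivProdArrow Y Z V).subtypeEquiv fun f => ?_).trans
    (Equiv.subtypeProdEquivProd (p := fun f : Y → V => σ ∘ f ∘ c = f)
      (q := fun f : Z → V => σ ∘ f ∘ c' = f)))
  simp [funext_iff]

theorem labelFix_of_isEmpty [IsEmpty Y] (c : Equiv.Perm Y) (σ : Equiv.Perm V) :
    labelFix c σ = 1 := by
  rw [labelFix_eq_card, Nat.card_eq_one_iff_unique]
  exact ⟨⟨fun a b => Subtype.ext (Subsingleton.elim _ _)⟩, ⟨isEmptyElim, Subsingleton.elim _ _⟩⟩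

/-- On an `r`-cycle the condition reads `σ (f (i + 1)) = f i`, so `f 0` determines `f`, and going
once around requires `σ ^ r` to fix `f 0`. -/
theorem labelFix_addRight (r : ℕ) [NeZero r] (σ : Equiv.Perm V) :
    labelFix (Equiv.addRight (1 : ZMod r)) σ = Nat.card {x : V // (σ ^ r) x = x} := by
  rw [labelFix_eq_card]
  have hiter : ∀ f : ZMod r → V, σ ∘ f ∘ Equiv.addRight (1 : ZMod r) = f →
      ∀ (k : ℕ) (i : ZMod r), (σ ^ k) (f (i + k)) = f i := by
    intro f hf k
    induction k with
    | zero => intro i; simp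
    | succ k ih =>
      intro i
      have h := congrFun hf (i + k)
      simp only [Function.comp_apply, Equiv.coe_addRight] at h
      rw [pow_succ, Equiv.Perm.mul_apply, Nat.cast_succ, ← add_assoc, h, ih]
  refine Nat.card_eq_of_bijective (fun f => ⟨f.1 0, by simpa using hiter f.1 f.2 r 0⟩) ⟨?_, ?_⟩
  · rintro ⟨f, hf⟩ ⟨g, hg⟩ hfg
    have h0 : f 0 = g 0 := by simpa using hfg
    apply Subtype.ext
    funext i
    have h1 := hiter f hf (-i).val i
    have h2 := hiter g hg (-i).val i
    rw [ZMod.natCast_zmod_val, add_neg_cancel] at h1 h2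
    exact h1.symm.trans ((congrArg _ h0).trans h2)
  · rintro ⟨x, hx⟩
    -- The exponent comes from `f i = σ ^ k (f (i + k))` with `i + k = 0`. The wrap-around of `val`
    -- modulo `r` is harmless because `x` has period `r` under `σ`.
    refine ⟨⟨fun i => (σ ^ (-i).val) x, ?_⟩, by simp⟩
    funext i
    have hper : Function.IsPeriodicPt σ r x := by
      rw [Function.IsPeriodicPt, Equiv.Perm.iterate_eq_pow]
      exact hx
    have h1 : (-i).val = ((-(i + 1)).val + 1) % r := by
      rw [← ZMod.val_natCast]
      congr 1
      simp
    simp only [Function.comp_apply, Equiv.coe_addRight]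
    rw [h1, ← Equiv.Perm.mul_apply, ← pow_succ', ← Equiv.Perm.iterate_eq_pow,
      ← Equiv.Perm.iterate_eq_pow, hper.iterate_mod_apply]

/-- The points of a cycle of length `p` are all fixed by `σ ^ r` if `p ∣ r`, and none is otherwise;
`w p` is the resulting contribution. Nontrivial cycles and fixed points of `σ` are counted
separately. -/
theorem card_pow_fixed_eq_sum [DecidableEq V] (r : ℕ) (hr : r ≠ 0) (σ : Equiv.Perm V) :
    Nat.card {x : V // (σ ^ r) x = x} = ∑ s ∈ r.divisors, s * σ.partition.parts.count s := by
  classical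
  let w : ℕ → ℕ := fun p => if p ∣ r then p else 0
  have h1 : (σ.partition.parts.map w).sum = ∑ s ∈ r.divisors, s * σ.partition.parts.count s := by
    rw [Finset.sum_multiset_map_count]
    have h2 : ∀ s, σ.partition.parts.count s • w s
        = if s ∈ r.divisors then s * σ.partition.parts.count s else 0 := by
      intro s
      simp only [w, Nat.mem_divisors, hr, ne_eq, not_false_eq_true, and_true, smul_eq_mul]
      split_ifs
      · exact mul_comm _ _
      · exact mul_zero _
    rw [Finset.sum_congr rfl fun s _ => h2 s, Finset.sum_ite_mem]
    refine Finset.sum_subset Finset.inter_subset_right fun s hs hs' => ?_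
    have : s ∉ σ.partition.parts := fun h =>
      hs' (Finset.mem_inter.2 ⟨Multiset.mem_toFinset.2 h, hs⟩)
    rw [Multiset.count_eq_zero_of_notMem this, mul_zero]
  rw [← h1, Equiv.Perm.parts_partition, Multiset.map_add, Multiset.sum_add,
    Multiset.map_replicate, Multiset.sum_replicate, Equiv.Perm.cycleType_def, Multiset.map_map]
  have h2 : (Multiset.map (w ∘ Finset.card ∘ Equiv.Perm.support) σ.cycleFactorsFinset.1).sum
      = (σ.support.filter fun x => (σ ^ r) x = x).card := by
    change ∑ τ ∈ σ.cycleFactorsFinset, w τ.support.card = _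
    have h3 : ∀ τ ∈ σ.cycleFactorsFinset, w τ.support.card
        = ((σ.support.filter fun x => (σ ^ r) x = x).filter fun x => σ.cycleOf x = τ).card := by
      intro τ hτ
      have hcyc := (Equiv.Perm.mem_cycleFactorsFinset_iff.1 hτ).1
      have hmem : ∀ x, x ∈ σ.support ∧ σ.cycleOf x = τ ↔ x ∈ τ.support := by
        intro x
        constructor
        · rintro ⟨hx, rfl⟩
          rw [Equiv.Perm.mem_support_cycleOf_iff]
          exact ⟨Equiv.Perm.SameCycle.refl _ _, hx⟩
        · intro hx
          exact ⟨Equiv.Perm.mem_cycleFactorsFinset_support_le hτ hx,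
            (Equiv.Perm.cycle_is_cycleOf hx hτ).symm⟩
      have hfix : ∀ x ∈ τ.support, ((σ ^ r) x = x ↔ τ.support.card ∣ r) := by
        intro x hx
        have hx' := ((hmem x).2 hx).2
        rw [← hcyc.orderOf, orderOf_dvd_iff_pow_eq_one, hcyc.pow_eq_one_iff'
          (Equiv.Perm.mem_support.1 hx), ← hx', Equiv.Perm.cycleOf_pow_apply_self]
      by_cases hd : τ.support.card ∣ r
      · simp only [w, hd, if_true]
        congr 1
        ext x
        simp only [Finset.mem_filter]
        rw [and_right_comm, hmem]
        exact ⟨fun h => ⟨h, (hfix x h).2 hd⟩, fun h => h.1⟩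
      · simp only [w, hd, if_false]
        symm
        rw [Finset.card_eq_zero, Finset.eq_empty_iff_forall_notMem]
        intro x hx
        simp only [Finset.mem_filter] at hx
        rw [and_right_comm, hmem] at hx
        exact hd ((hfix x hx.1).1 hx.2)
    rw [Finset.sum_congr rfl h3]
    refine (Finset.card_eq_sum_card_fiberwise fun x hx => ?_).symm
    exact Equiv.Perm.cycleOf_mem_cycleFactorsFinset_iff.2 (Finset.mem_filter.1 hx).1
  rw [h2, Nat.card_eq_fintype_card, Fintype.card_subtype]
  have h4 : (Finset.univ.filter fun x => (σ ^ r) x = x)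
      = (σ.support.filter fun x => (σ ^ r) x = x) ∪ σ.supportᶜ := by
    ext x
    simp only [Finset.mem_filter, Finset.mem_univ, true_and, Finset.mem_union, Finset.mem_compl]
    by_cases hx : x ∈ σ.support
    · simp [hx]
    · have : σ x = x := by simpa using hx
      simp [hx, Equiv.Perm.pow_apply_eq_self_of_apply_eq_self this]
  rw [h4, Finset.card_union_of_disjoint, Finset.card_compl]
  · simp [w]
  · rw [Finset.disjoint_left]
    intro x hx hx'
    exact Finset.mem_compl.1 hx' (Finset.mem_filter.1 hx).1

end LabelFix

/-! ### Character polynomials as combinations of labeling counts -/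

section CharacterPolynomials

variable (K : Type*) [Field K]

/-- Families of functions on the symmetric groups that are combinations of the numbers of labelings
fixed by a permutation. -/
def labelSpan : Submodule K (∀ n : ℕ, Equiv.Perm (Fin n) → K) :=
  Submodule.span K (Set.range fun kc : (Σ k : ℕ, Equiv.Perm (Fin k)) =>
    fun _ σ => (labelFix kc.2 σ : K))

theorem labelFix_mem_labelSpan {Y : Type*} [Fintype Y] (c : Equiv.Perm Y) :
    (fun _ σ => (labelFix c σ : K) : ∀ n : ℕ, Equiv.Perm (Fin n) → K) ∈ labelSpan K := by
  refine Submodule.subset_span ⟨⟨Fintype.card Y, (Fintype.equivFin Y).permCongr c⟩, ?_⟩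
  funext n σ
  exact congrArg Nat.cast (labelFix_permCongr (Fintype.equivFin Y) c σ)

theorem mul_mem_labelSpan {F G : ∀ n : ℕ, Equiv.Perm (Fin n) → K} (hF : F ∈ labelSpan K)
    (hG : G ∈ labelSpan K) : F * G ∈ labelSpan K := by
  have h : labelSpan K * labelSpan K ≤ labelSpan K := by
    conv_lhs => rw [labelSpan, Submodule.span_mul_span]
    rw [Submodule.span_le]
    rintro _ ⟨_, ⟨⟨k, c⟩, rfl⟩, _, ⟨⟨k', c'⟩, rfl⟩, rfl⟩
    convert! labelFix_mem_labelSpan K (Equiv.Perm.sumCongr c c') using 1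
    funext n σ
    simp [labelFix_sumCongr]
  exact h (Submodule.mul_mem_mul hF hG)

theorem one_mem_labelSpan : (1 : ∀ n : ℕ, Equiv.Perm (Fin n) → K) ∈ labelSpan K := by
  convert! labelFix_mem_labelSpan K (1 : Equiv.Perm (Fin 0)) using 1
  funext n σ
  simp [labelFix_of_isEmpty]

/-- The count for an `r`-cycle is `∑ s * X_s` over `s ∣ r`. This system is triangular with diagonal
entries `r`, invertible in characteristic zero. -/
theorem count_mem_labelSpan [CharZero K] (r : ℕ) (hr : r ≠ 0) :
    (fun _ σ => (σ.partition.parts.count r : K) : ∀ n : ℕ, Equiv.Perm (Fin n) → K)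
      ∈ labelSpan K := by
  induction r using Nat.strong_induction_on with
  | _ r ih =>
    have : NeZero r := ⟨hr⟩
    have h1 := labelFix_mem_labelSpan K (Equiv.addRight (1 : ZMod r))
    have h2 : ∑ s ∈ r.properDivisors, (s : K) •
        (fun _ σ => (σ.partition.parts.count s : K) : ∀ n : ℕ, Equiv.Perm (Fin n) → K)
          ∈ labelSpan K := by
      refine Submodule.sum_mem _ fun s hs => Submodule.smul_mem _ _ (ih s ?_ ?_)
      · exact (Nat.mem_properDivisors.1 hs).2
      · exact (Nat.pos_of_mem_properDivisors hs).ne'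
    have h3 := Submodule.smul_mem _ (r : K)⁻¹ (Submodule.sub_mem _ h1 h2)
    convert! h3 using 1
    funext n σ
    simp only [Pi.smul_apply, Pi.sub_apply, Finset.sum_apply, smul_eq_mul]
    rw [labelFix_addRight, card_pow_fixed_eq_sum r hr, ← Nat.insert_self_properDivisors hr,
      Finset.sum_insert Nat.self_notMem_properDivisors]
    have : (r : K) ≠ 0 := Nat.cast_ne_zero.2 hr
    field_simp
    push_cast
    ring

theorem charPolyFun_mem_labelSpan [CharZero K] (P : MvPolynomial ℕ+ K) :
    (fun n σ => charPolyFun P n σ) ∈ labelSpan K := by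
  induction P using MvPolynomial.induction_on with
  | C a =>
    convert! Submodule.smul_mem _ a (one_mem_labelSpan K) using 1
    funext n σ
    simp [charPolyFun]
  | add p q hp hq =>
    convert! Submodule.add_mem _ hp hq using 1
    funext n σ
    simp [charPolyFun]
  | mul_X p r hp =>
    convert! mul_mem_labelSpan K hp (count_mem_labelSpan K r r.ne_zero) using 1
    funext n σ
    simp [charPolyFun, cycleCount]

end CharacterPolynomials

/-! ### Limits of the inner products and summability -/

namespace ArnoldAlgebra

/-- Before passing to coinvariants, `σ` composed with the relabelling has trace `labelFix c σ` times
the character; averaging over `σ` gives the trace on the coinvariants. -/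
theorem trace_relabelCoinv (K : Type*) [Field K] [CharZero K] {Y : Type*} [Fintype Y]
    (c : Equiv.Perm Y) (d n : ℕ) :
    LinearMap.trace K (ArnoldCoinv K Y (Fin n) d) (relabelCoinv (pieceRep K (Fin n) d) c)
      = (Fintype.card (Equiv.Perm (Fin n)) : K)⁻¹ *
        ∑ σ, (labelFix c σ : K) * (pieceRep K (Fin n) d).character σ := by
  classical
  rw [relabelCoinv, trace_coinvariants_map]
  congr 1
  refine Finset.sum_congr rfl fun σ _ => ?_
  have h : labelledRep Y (pieceRep K (Fin n) d) σ ∘ₗ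
      (relabel (pieceRep K (Fin n) d) c).toLinearMap
        = labelMap (fun f => σ ∘ f ∘ c) (pieceRep K (Fin n) d σ) := by
    ext f x : 2
    simp [relabel, labelledRep_single]
  rw [h, trace_labelMap, Representation.character, labelFix]
  congr!

end ArnoldAlgebra

open ArnoldAlgebra

theorem exists_trace_limit (K : Type*) [Field K] [CharZero K] [Algebra K ℂ] {Y : Type*}
    [Fintype Y] (c : Equiv.Perm Y) (d : ℕ) :
    ∃ t : K, (∀ᶠ n : ℕ in atTop, (Fintype.card (Equiv.Perm (Fin n)) : K)⁻¹ *
        ∑ σ, (labelFix c σ : K) * (pieceRep K (Fin n) d).character σ = t) ∧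
      ‖algebraMap K ℂ t‖ ≤ 2 ^ d * (2 * d + Fintype.card Y : ℝ) ^ Fintype.card Y := by
  obtain ⟨b, hab, hb⟩ := exists_trace_eventually_eq
    (fun n => ArnoldCoinv K Y (Fin n) d) (fun n => relabelCoinv (pieceRep K (Fin n) d) c)
    (fun n => arnoldCoinvMap K Y Fin.castSuccEmb d)
    (fun n => coinvMap_relabelCoinv _ _ _ c) (2 * d + Fintype.card Y)
    (fun n hn => arnoldCoinvMap_castSucc_surjective K Y hn)
  refine ⟨LinearMap.trace K _ (relabelCoinv (pieceRep K (Fin b) d) c),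
    eventually_atTop.2 ⟨b, fun n hn => ?_⟩, ?_⟩
  · rw [← trace_relabelCoinv]
    exact (hb n hn).1
  · refine (norm_trace_le_finrank _ (orderOf_pos c).ne' (relabelCoinv_pow_orderOf _ c)).trans ?_
    -- The dimension is estimated at the first stage where surjectivity holds, which gives the
    -- polynomial factor in `d`.
    have h := (hb b le_rfl).2.trans (finrank_arnoldCoinv_le K Y (2 * d + Fintype.card Y) d)
    exact_mod_cast h

theorem summable_two_pow_mul_pow_div (a : ℕ) {q : ℝ} (hq : 2 < q) :
    Summable fun d : ℕ => 2 ^ d * (2 * d + a : ℝ) ^ a / q ^ d := by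
  have hq0 : 0 < q := by linarith
  have h1 : ‖2 / q‖ < 1 := by
    rw [Real.norm_of_nonneg (by positivity), div_lt_one hq0]
    exact hq
  have h2 := (summable_pow_mul_geometric_of_norm_lt_one a h1).mul_left ((2 + a : ℝ) ^ a)
  refine Summable.of_norm_bounded_eventually_nat h2 ?_
  filter_upwards [eventually_ge_atTop 1] with d hd
  have hd' : (1 : ℝ) ≤ d := by exact_mod_cast hd
  rw [Real.norm_of_nonneg (by positivity), div_pow, ← mul_assoc, ← mul_pow, mul_comm (2 ^ d : ℝ),
    mul_div_assoc]
  gcongr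
  -- For `d ≥ 1`, `2 * d + a ≤ (2 + a) * d`.
  nlinarith [Nat.cast_nonneg (α := ℝ) a]

theorem proposition3p5 (K : Subfield ℂ) (q : ℝ) (hq : 3 ≤ q) (P : MvPolynomial ℕ+ K) :
    ∃ L : ℕ → ℂ,
      (∀ d : ℕ, Tendsto (fun n : ℕ => arnoldInner K P d n) atTop (𝓝 (L d))) ∧
      Summable (fun d : ℕ => ‖L d / (q : ℂ) ^ d‖) := by
  let I : (∀ n : ℕ, Equiv.Perm (Fin n) → K) → ℕ → ℕ → ℂ := fun F d n =>
    classInner (fun σ => (F n σ : ℂ))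
      (fun σ => (((pieceRep K (Fin n) d).character σ : K) : ℂ))
  suffices h : ∀ F ∈ labelSpan K, ∃ L : ℕ → ℂ,
      (∀ d : ℕ, Tendsto (fun n : ℕ => I F d n) atTop (𝓝 (L d))) ∧
      Summable (fun d : ℕ => ‖L d / (q : ℂ) ^ d‖) from
    h _ (charPolyFun_mem_labelSpan K P)
  intro F hF
  induction hF using Submodule.span_induction with
  | mem F hF =>
    obtain ⟨⟨k, c⟩, rfl⟩ := hF
    choose t ht ht' using exists_trace_limit K c
    -- The inner product conjugates the character, while `labelFix` is a natural number, so the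
    -- limit is the conjugate of the stable trace.
    refine ⟨fun d => starRingEnd ℂ (t d : ℂ), fun d => ?_, ?_⟩
    · refine tendsto_const_nhds.congr' ?_
      filter_upwards [ht d] with n hn
      rw [← hn]
      simp [I, classInner]
    · refine Summable.of_nonneg_of_le (fun _ => norm_nonneg _) (fun d => ?_)
        (summable_two_pow_mul_pow_div (Fintype.card (Fin k)) (q := q) (by linarith))
      rw [norm_div, norm_pow, RCLike.norm_conj, Complex.norm_real,
        Real.norm_of_nonneg (by linarith)]
      gcongr
      exact ht' d
  | zero => exact ⟨0, fun d => by simp [I, classInner], by simp⟩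
  | add F G _ _ hF hG =>
    obtain ⟨L, h1, h2⟩ := hF
    obtain ⟨M, h3, h4⟩ := hG
    refine ⟨L + M, fun d => ?_, ?_⟩
    · refine ((h1 d).add (h3 d)).congr fun n => ?_
      simp [I, classInner, add_mul, Finset.sum_add_distrib, mul_add]
    · refine Summable.of_nonneg_of_le (fun _ => norm_nonneg _) (fun d => ?_) (h2.add h4)
      rw [Pi.add_apply, add_div]
      exact norm_add_le _ _
  | smul a F _ hF =>
    obtain ⟨L, h1, h2⟩ := hF
    refine ⟨(a : ℂ) • L, fun d => ?_, ?_⟩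
    · refine ((h1 d).const_mul (a : ℂ)).congr fun n => ?_
      simp only [I, classInner, Pi.smul_apply, smul_eq_mul, Subfield.coe_mul, Finset.mul_sum]
      refine Finset.sum_congr rfl fun σ _ => ?_
      ring
    · refine (h2.mul_left ‖(a : ℂ)‖).congr fun d => ?_
      rw [Pi.smul_apply, smul_eq_mul, mul_div_assoc, norm_mul]

end
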